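/- Let $H$ be a real Hilbert space and let $H^{\otimes n}$ be its completed (Hilbert space) $n$-th tensor power. For integers $k,q\ge 0$ with $k+q=n$, let $H_{k,q}=H^{\odot k}\otimes H^{\wedge q}\subset H^{\otimes n}$ be the closed subspace of tensors that are symmetric in the first $k$ components and skew-symmetric in the last $q$ components, and let $H^{\odot[k],\wedge[q]}\subset H^{\otimes n}$ be the closed linear span of all tensors that are symmetric in some $k$ of the components and skew-symmetric in the remaining $q$; both spaces are $0$ by convention when $k$ or $q$ is negative. Put $$H_{k,q}^+=H_{k,q}\cap H^{\odot[k+1],\wedge[q-1]},\qquad H_{k,q}^-=H_{k,q}\cap H^{\odot[k-1],\wedge[q+1]} .$$ With $h_1\odot\cdots\odot h_k=\sum_{\rho\in\mathfrak S_k}h_{\rho(1)}\otimes\cdots\otimes h_{\rho(k)}$ and $x_1\wedge\cdots\wedge x_q=\sum_{\rho\in\mathfrak S_q}\operatorname{sgn}(\rho)\,x_{\rho(1)}\otimes\cdots\otimes x_{\rho(q)}$, let $\breve d_q:H_{k,q}\to H_{k-1,q+1}$ and $\breve d_q^*:H_{k-1,q+1}\to H_{k,q}$ be the bounded linear operators determined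 by $$\breve d_q(h_1\odot\cdots\odot h_k\otimes x_1\wedge\cdots\wedge x_q)=\sum_{j=1}^k h_1\odot\cdots\odot\hat h_j\odot\cdots\odot h_k\otimes h_j\wedge x_1\wedge\cdots\wedge x_q ,$$ $$\breve d_q^*(h_1\odot\cdots\odot h_{k-1}\otimes x_1\wedge\cdots\wedge x_{q+1})=\sum_{i=1}^{q+1}(-1)^{i-1}h_1\odot\cdots\odot h_{k-1}\odot x_i\otimes x_1\wedge\cdots\wedge\hat x_i\wedge\cdots\wedge x_{q+1},$$ where $\hat{\ }$ denotes omission, $\breve d_q=0$ on $H_{0,q}$, and operators to or from a space with a negative index are $0$. Equivalently, $\breve d_q=(q+1)\,\mathrm{id}\otimes A_{q+1}$ on $H_{k,q}$ for $k\ge1$ and $\breve d_q^*=k\,S_k\otimes\mathrm{id}$ on $H_{k-1,q+1}$, where $A_{q+1}$ and $S_k$ are the skew-symmetrisation and symmetrisation projections on the last $q+1$ and on the first $k$ components. Then for all integers $k,q\ge0$ with $k+q\ge1$: 1. $H_{k,q}^+=\operatorname{Im}(\breve d_{q-1}|_{H_{k+1,q-1}})=\operatorname{Ker}(\breve d_q|_{H_{k,q}})$;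 2. $H_{k,q}^-=\operatorname{Im}(\breve d_q^*|_{H_{k-1,q+1}})=\operatorname{Ker}(\breve d_{q-1}^*|_{H_{k,q}})$; 3. $\operatorname{Ker}(\breve d_{q-1}^*|_{H_{k,q}})\cap\operatorname{Ker}(\breve d_q|_{H_{k,q}})=\{0\}$. -/

import Mathlib

open scoped TensorProduct

noncomputable section

namespace FockForms

/-- The algebraic `n`-fold tensor power of `H` (a separate type, so that it can carry the Hilbert
cross norm). -/
def AlgTensor (H : Type*) [NormedAddCommGroup H] [InnerProductSpace ℝ H] (n : ℕ) : Type _ :=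
  ⨂[ℝ] _ : Fin n, H

section Build

variable {H : Type*} [NormedAddCommGroup H] [InnerProductSpace ℝ H] {n : ℕ}

instance : AddCommGroup (AlgTensor H n) := inferInstanceAs (AddCommGroup (⨂[ℝ] _ : Fin n, H))
instance : Module ℝ (AlgTensor H n) := inferInstanceAs (Module ℝ (⨂[ℝ] _ : Fin n, H))

/-- The pure tensor `h₁ ⊗ ⋯ ⊗ hₙ`. -/
def algPure : MultilinearMap ℝ (fun _ : Fin n => H) (AlgTensor H n) := PiTensorProduct.tprod ℝ

/-- The bilinear form with `⟨h₁ ⊗ ⋯ ⊗ hₙ, g₁ ⊗ ⋯ ⊗ gₙ⟩ = ∏ ⟨hᵢ, gᵢ⟩`. -/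
def algInner : AlgTensor H n →ₗ[ℝ] AlgTensor H n →ₗ[ℝ] ℝ :=
  (PiTensorProduct.dualDistrib (R := ℝ) (ι := Fin n) (M := fun _ => H)) ∘ₗ
    PiTensorProduct.map (fun _ => innerₗ H)

theorem algInner_pure (f g : Fin n → H) :
    algInner (algPure f) (algPure g) = ∏ i, inner ℝ (f i) (g i) := by
  have h : PiTensorProduct.dualDistrib (R := ℝ) (M := fun _ : Fin n => H)
      (PiTensorProduct.map (fun _ => innerₗ H) (PiTensorProduct.tprod ℝ f))
      (PiTensorProduct.tprod ℝ g) = ∏ i, inner ℝ (f i) (g i) := by simp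
  exact h

theorem alg_ext {E : Type*} [AddCommMonoid E] [Module ℝ E] {φ ψ : AlgTensor H n →ₗ[ℝ] E}
    (h : ∀ f, φ (algPure f) = ψ (algPure f)) : φ = ψ :=
  PiTensorProduct.ext (MultilinearMap.ext h)

theorem algInner_symm (x y : AlgTensor H n) : algInner x y = algInner y x := by
  have : (algInner (H := H) (n := n)) = algInner.flip := by
    refine alg_ext fun f => alg_ext fun g => ?_
    simp [algInner_pure, real_inner_comm]
  exact congrArg (fun B => B x y) this

/-- The map induced on tensor powers by the inclusion of a subspace. -/
def algIncl (V : Submodule ℝ H) : AlgTensor V n →ₗ[ℝ] AlgTensor H n :=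
  PiTensorProduct.map (fun _ => V.subtype)

theorem algIncl_pure (V : Submodule ℝ H) (f : Fin n → V) :
    algIncl V (algPure f) = algPure (fun i => (f i : H)) :=
  PiTensorProduct.map_tprod _ _

theorem algInner_incl (V : Submodule ℝ H) (x y : AlgTensor V n) :
    algInner (algIncl V x) (algIncl V y) = algInner x y := by
  have : (algInner (H := H) (n := n)).compl₁₂ (algIncl V) (algIncl V) = algInner := by
    refine alg_ext fun f => alg_ext fun g => ?_
    simp [algInner_pure, algIncl_pure]
  exact congrArg (fun B => B x y) this

theorem algIncl_mono {V W : Submodule ℝ H} (h : V ≤ W) (x : AlgTensor V n) :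
    ∃ y : AlgTensor W n, algIncl W y = algIncl V x := by
  refine ⟨PiTensorProduct.map (fun _ => Submodule.inclusion h) x, ?_⟩
  have : (algIncl W) ∘ₗ (PiTensorProduct.map (fun _ => Submodule.inclusion h)) =
      algIncl (n := n) V := by
    refine PiTensorProduct.ext (MultilinearMap.ext fun f => ?_)
    have h1 : PiTensorProduct.map (fun _ => W.subtype)
        (PiTensorProduct.map (fun _ : Fin n => Submodule.inclusion h) (PiTensorProduct.tprod ℝ f)) =
        PiTensorProduct.map (fun _ => V.subtype) (PiTensorProduct.tprod ℝ f) := by simp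
    exact h1
  exact congrArg (fun B => B x) this

theorem exists_algIncl (x : AlgTensor H n) :
    ∃ V : Submodule ℝ H, FiniteDimensional ℝ V ∧ ∃ y : AlgTensor V n, algIncl V y = x := by
  induction x using PiTensorProduct.induction_on with
  | smul_tprod r f =>
    refine ⟨Submodule.span ℝ (Set.range f), FiniteDimensional.span_of_finite ℝ (Set.finite_range f),
      r • algPure (fun i => ⟨f i, Submodule.subset_span ⟨i, rfl⟩⟩), ?_⟩
    rw [map_smul, algIncl_pure]
    rfl
  | add x y hx hy =>
    obtain ⟨V, hV, x', rfl⟩ := hx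
    obtain ⟨W, hW, y', rfl⟩ := hy
    obtain ⟨x'', hx''⟩ := algIncl_mono (le_sup_left : V ≤ V ⊔ W) x'
    obtain ⟨y'', hy''⟩ := algIncl_mono (le_sup_right : W ≤ V ⊔ W) y'
    refine ⟨V ⊔ W, inferInstance, x'' + y'', ?_⟩
    rw [map_add, hx'', hy'']
    rfl

theorem algInner_self_of_finite [FiniteDimensional ℝ H] (x : AlgTensor H n) :
    0 ≤ algInner x x ∧ (algInner x x = 0 → x = 0) := by
  classical
  let e := stdOrthonormalBasis ℝ H
  let b : Module.Basis _ ℝ (AlgTensor H n) :=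
    Basis.piTensorProduct (fun _ : Fin n => e.toBasis)
  have hb : ∀ p, b p = algPure (fun i => e (p i)) := fun p => by
    have h1 := Basis.piTensorProduct_apply (fun _ : Fin n => e.toBasis) p
    simp only [OrthonormalBasis.coe_toBasis] at h1
    exact h1
  have horth : ∀ p p', algInner (b p) (b p') = if p = p' then 1 else 0 := by
    intro p p'
    simp only [hb, algInner_pure, e.inner_eq_ite, Fintype.prod_ite_zero, ← funext_iff]
    simp
  have hx : algInner x x = ∑ p, b.repr x p ^ 2 := by
    conv_lhs => rw [← b.sum_repr x]
    simp only [map_sum, LinearMap.sum_apply, map_smul, LinearMap.smul_apply, horth, smul_eq_mul,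
      mul_ite, mul_one, mul_zero, Finset.sum_ite_eq', Finset.mem_univ, if_true,
      pow_two]
  rw [hx]
  refine ⟨Finset.sum_nonneg fun _ _ => sq_nonneg _, fun h => ?_⟩
  rw [Finset.sum_eq_zero_iff_of_nonneg (fun _ _ => sq_nonneg _)] at h
  exact b.ext_elem (by simpa using h)

/-- The inner product of the algebraic tensor power. -/
instance algCore : InnerProductSpace.Core ℝ (AlgTensor H n) where
  inner x y := algInner x y
  conj_inner_symm x y := algInner_symm y x
  add_left x y z := by simp
  smul_left x y r := by simp
  re_inner_nonneg x := by
    obtain ⟨V, hV, y, rfl⟩ := exists_algIncl x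
    simpa [algInner_incl] using (algInner_self_of_finite y).1
  definite x h := by
    obtain ⟨V, hV, y, rfl⟩ := exists_algIncl x
    rw [(algInner_self_of_finite y).2 (by rw [← algInner_incl]; exact h), map_zero]

instance : NormedAddCommGroup (AlgTensor H n) :=
  InnerProductSpace.Core.toNormedAddCommGroup (𝕜 := ℝ)

instance : InnerProductSpace ℝ (AlgTensor H n) := InnerProductSpace.ofCore _

theorem alg_inner_def (x y : AlgTensor H n) : inner ℝ x y = algInner x y := rfl

end Build

/-- The completed Hilbert space tensor power `H^{⊗n}`. -/
abbrev HTensor (H : Type*) [NormedAddCommGroup H] [InnerProductSpace ℝ H] (n : ℕ) : Type _ :=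
  UniformSpace.Completion (AlgTensor H n)

section Ops

variable {H : Type*} [NormedAddCommGroup H] [InnerProductSpace ℝ H] {n : ℕ}

/-- The pure tensor `h₁ ⊗ ⋯ ⊗ hₙ` in `H^{⊗n}`. -/
def pureTensor (h : Fin n → H) : HTensor H n := ((algPure h : AlgTensor H n) : HTensor H n)

theorem inner_pure (f g : Fin n → H) :
    inner ℝ (pureTensor f) (pureTensor g) = ∏ i, inner ℝ (f i) (g i) := by
  rw [pureTensor, pureTensor, UniformSpace.Completion.inner_coe, alg_inner_def, algInner_pure]

theorem dense_span_pure :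
    (Submodule.span ℝ (Set.range (pureTensor : (Fin n → H) → HTensor H n))).topologicalClosure = ⊤ := by
  have h1 : Submodule.span ℝ (Set.range (algPure : (Fin n → H) → AlgTensor H n)) = ⊤ :=
    PiTensorProduct.span_tprod_eq_top
  have h2 : Set.range (pureTensor : (Fin n → H) → HTensor H n) =
      (UniformSpace.Completion.toComplL (𝕜 := ℝ) (E := AlgTensor H n)).toLinearMap ''
        Set.range (algPure : (Fin n → H) → AlgTensor H n) := by
    rw [← Set.range_comp]; rfl
  rw [h2, ← Submodule.map_span, h1, Submodule.map_top]
  rw [← Submodule.dense_iff_topologicalClosure_eq_top]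
  exact UniformSpace.Completion.denseRange_coe

/-- The action of a permutation on the algebraic tensor power:
`h₁ ⊗ ⋯ ⊗ hₙ ↦ h_{σ(1)} ⊗ ⋯ ⊗ h_{σ(n)}`. -/
def algPermute (σ : Equiv.Perm (Fin n)) : AlgTensor H n →ₗ[ℝ] AlgTensor H n :=
  PiTensorProduct.lift ((algPure (H := H) (n := n)).domDomCongr σ)

theorem algPermute_pure (σ : Equiv.Perm (Fin n)) (h : Fin n → H) :
    algPermute σ (algPure h) = algPure (h ∘ σ) := by
  simp only [algPermute, algPure]
  erw [PiTensorProduct.lift.tprod]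
  rfl

theorem algPermute_inner (σ : Equiv.Perm (Fin n)) (x y : AlgTensor H n) :
    algInner (algPermute σ x) (algPermute σ y) = algInner x y := by
  have : (algInner (H := H) (n := n)).compl₁₂ (algPermute σ) (algPermute σ) = algInner := by
    refine alg_ext fun f => alg_ext fun g => ?_
    simp only [LinearMap.compl₁₂_apply, algPermute_pure, algInner_pure, Function.comp_apply]
    exact Equiv.prod_comp σ fun i => inner ℝ (f i) (g i)
  exact congrArg (fun B => B x y) this

/-- The action of a permutation on `H^{⊗n}`, determined by
`h₁ ⊗ ⋯ ⊗ hₙ ↦ h_{σ(1)} ⊗ ⋯ ⊗ h_{σ(n)}`. -/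
def permute (σ : Equiv.Perm (Fin n)) : HTensor H n →L[ℝ] HTensor H n :=
  ((algPermute σ).isometryOfInner (algPermute_inner σ)).toContinuousLinearMap.completion

theorem permute_pure (σ : Equiv.Perm (Fin n)) (h : Fin n → H) :
    permute σ (pureTensor h) = pureTensor (h ∘ σ) := by
  simp only [permute, pureTensor, ContinuousLinearMap.completion_apply_coe]
  congr 1
  exact algPermute_pure σ h

/-- The operator `S_a`, symmetrising an `n`-tensor in the components specified by `a`. -/
def symOn (a : Finset (Fin n)) : HTensor H n →L[ℝ] HTensor H n :=
  ((a.card.factorial : ℝ)⁻¹) • ∑ ρ : Equiv.Perm {i // i ∈ a}, permute (Equiv.Perm.ofSubtype ρ)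

/-- The operator `A_a`, skew-symmetrising an `n`-tensor in the components specified by `a`. -/
def skewOn (a : Finset (Fin n)) : HTensor H n →L[ℝ] HTensor H n :=
  ((a.card.factorial : ℝ)⁻¹) • ∑ ρ : Equiv.Perm {i // i ∈ a},
    ((Equiv.Perm.sign ρ : ℤ) : ℝ) • permute (Equiv.Perm.ofSubtype ρ)

end Ops

variable (H : Type*) [NormedAddCommGroup H] [InnerProductSpace ℝ H] (n : ℕ)

/-- `H^{⊙a, ∧aᶜ}`: the elements of `H^{⊗n}` that are symmetric in the components specified by `a`
and skew-symmetric in the remaining ones. -/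
def symSkew (a : Finset (Fin n)) : Submodule ℝ (HTensor H n) where
  carrier := {x | (∀ ρ : Equiv.Perm {i // i ∈ a}, permute (Equiv.Perm.ofSubtype ρ) x = x) ∧
    ∀ ρ : Equiv.Perm {i // i ∈ aᶜ},
      permute (Equiv.Perm.ofSubtype ρ) x = ((Equiv.Perm.sign ρ : ℤ) : ℝ) • x}
  add_mem' hx hy := ⟨fun ρ => by rw [map_add, hx.1, hy.1],
    fun ρ => by rw [map_add, hx.2, hy.2, smul_add]⟩
  zero_mem' := ⟨fun ρ => map_zero _, fun ρ => by rw [map_zero, smul_zero]⟩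
  smul_mem' c x hx := ⟨fun ρ => by rw [map_smul, hx.1],
    fun ρ => by rw [map_smul, hx.2, smul_comm]⟩

/-- `H^{⊙[k], ∧[q]}` inside `H^{⊗n}`, `n = k + q`: the closed linear span of the elements symmetric
in some `k` components and skew-symmetric in the remaining `q` components. There are no such
components, and the span is `0`, if `k` or `q` is negative. -/
def mixed (k q : ℤ) : Submodule ℝ (HTensor H n) :=
  (⨆ a ∈ {a : Finset (Fin n) | (a.card : ℤ) = k ∧ (aᶜ.card : ℤ) = q},
    symSkew H n a).topologicalClosure

/-- The first `k` of the `n` components. -/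
def firstPos (k : ℤ) : Finset (Fin n) := Finset.univ.filter fun i => (i : ℤ) < k

/-- The last `q` of the `n` components. -/
def lastPos (q : ℤ) : Finset (Fin n) := Finset.univ.filter fun i => (n : ℤ) ≤ (i : ℤ) + q

/-- `H_{k,q} = H^{⊙k} ⊗ H^{∧q}` inside `H^{⊗n}`, `n = k + q`: the elements symmetric in the first
`k` components and skew-symmetric in the last `q` ones. It is `0` if `k` or `q` is negative. -/
def Hkq (k q : ℤ) : Submodule ℝ (HTensor H n) :=
  if 0 ≤ k ∧ 0 ≤ q ∧ k + q = n then symSkew H n (firstPos n k) else ⊥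

/-- `H_{k,q}^+ = H_{k,q} ∩ H^{⊙[k+1], ∧[q-1]}`. -/
def HkqPlus (k q : ℤ) : Submodule ℝ (HTensor H n) := Hkq H n k q ⊓ mixed H n (k + 1) (q - 1)

/-- `H_{k,q}^- = H_{k,q} ∩ H^{⊙[k-1], ∧[q+1]}`. -/
def HkqMinus (k q : ℤ) : Submodule ℝ (HTensor H n) := Hkq H n k q ⊓ mixed H n (k - 1) (q + 1)

/-- The operator `d̆_q` on `H_{n-q,q}`, namely `(q + 1) id ⊗ A_{q+1}`, which skew-symmetrises the
last `q + 1` components; it is `0` on `H_{0,n}` and for `q < 0`. -/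
def breveD (q : ℤ) : HTensor H n →L[ℝ] HTensor H n :=
  if 0 ≤ q ∧ q < n then ((q : ℝ) + 1) • skewOn (lastPos n (q + 1)) else 0

/-- The operator `d̆_q^*` on `H_{k-1,q+1}`, `k = n - q`, namely `k S_k ⊗ id`, which symmetrises the
first `k` components; it is `0` for `q < 0`, i.e. on `H_{n,0}`. -/
def breveDStar (q : ℤ) : HTensor H n →L[ℝ] HTensor H n :=
  if 0 ≤ q ∧ q < n then ((n : ℝ) - q) • symOn (firstPos n (n - q)) else 0


section Elementary

variable {H : Type*} [NormedAddCommGroup H] [InnerProductSpace ℝ H] {n k q : ℕ}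

/-- The `n`-tuple, `n = k + q`, made of a `k`-tuple followed by a `q`-tuple. -/
def joinTuple (e : k + q = n) (h : Fin k → H) (x : Fin q → H) : Fin n → H :=
  fun i => Fin.append h x (Fin.cast e.symm i)

/-- The elementary tensor `h₁ ⊙ ⋯ ⊙ h_k ⊗ x₁ ∧ ⋯ ∧ x_q` of `H^{⊗n}`, `n = k + q`, where
`h₁ ⊙ ⋯ ⊙ h_k = ∑ σ, h_{σ(1)} ⊗ ⋯ ⊗ h_{σ(k)}` and
`x₁ ∧ ⋯ ∧ x_q = ∑ ρ, sgn ρ • x_{ρ(1)} ⊗ ⋯ ⊗ x_{ρ(q)}`. -/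
def elementary (e : k + q = n) (h : Fin k → H) (x : Fin q → H) : HTensor H n :=
  ∑ σ : Equiv.Perm (Fin k), ∑ ρ : Equiv.Perm (Fin q),
    ((Equiv.Perm.sign ρ : ℤ) : ℝ) • pureTensor (joinTuple e (h ∘ σ) (x ∘ ρ))

theorem joinTuple_shift (e : k + 1 + q = n) (e' : k + (q + 1) = n) (g : Fin k → H) (y : H)
    (x : Fin q → H) :
    joinTuple e (Fin.snoc g y : Fin (k + 1) → H) x =
      joinTuple e' g (Fin.cons y x : Fin (q + 1) → H) := by
  subst e'
  funext i
  simp only [joinTuple, Fin.append, Fin.addCases, Fin.snoc, Fin.cons, Fin.val_cast]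
  rcases lt_trichotomy (i : ℕ) k with hi | hi | hi
  · simp [hi, Nat.lt_succ_of_lt hi]; rfl
  · have : i = Fin.natAdd k 0 := Fin.ext (by simp [hi])
    subst this
    simp only [Fin.val_natAdd, Fin.val_zero, add_zero, lt_add_iff_pos_right, zero_lt_one, dif_pos,
      lt_self_iff_false, dif_neg, not_false_iff]
    simp
  · obtain ⟨j, hj⟩ : ∃ j : Fin q, i = Fin.natAdd k j.succ :=
      ⟨⟨i - k - 1, by omega⟩, Fin.ext (by simp; omega)⟩
    subst hj
    have h1 : ¬ (k + ((j : ℕ) + 1) < k + 1) := by omega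
    have h2 : ¬ (k + ((j : ℕ) + 1) < k) := by omega
    simp [h1, h2]
    congr 1
    exact Fin.ext (by simp; omega)

/-- The first `k` positions. -/
def firstEquiv (e : k + q = n) : Fin k ≃ {i // i ∈ firstPos n k} where
  toFun i := ⟨Fin.cast e (Fin.castAdd q i), by simp [firstPos]⟩
  invFun i := ⟨i.1, by have := i.2; simp [firstPos] at this; exact this⟩
  left_inv i := rfl
  right_inv i := rfl

/-- The last `q` positions. -/
def lastEquiv (e : k + q = n) : Fin q ≃ {i // i ∈ lastPos n q} where
  toFun i := ⟨Fin.cast e (Fin.natAdd k i), by subst e; simp [lastPos]⟩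
  invFun i := ⟨(i.1 : ℕ) - k, by have := i.2; simp [lastPos] at this; omega⟩
  left_inv i := Fin.ext (by simp)
  right_inv i := Subtype.ext (Fin.ext (by
    have := i.2; simp [lastPos] at this; simp; omega))

theorem joinTuple_first (e : k + q = n) (h : Fin k → H) (x : Fin q → H) (σ : Equiv.Perm (Fin k)) :
    joinTuple e h x ∘ Equiv.Perm.ofSubtype ((firstEquiv e).permCongr σ) =
      joinTuple e (h ∘ σ) x := by
  subst e
  funext i
  refine Fin.addCases (fun j => ?_) (fun j => ?_) i
  · have hm : Fin.castAdd q j ∈ firstPos (k + q) k := (firstEquiv rfl j).2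
    rw [Function.comp_apply, Equiv.Perm.ofSubtype_apply_of_mem _ hm]
    have : (⟨Fin.castAdd q j, hm⟩ : {i // i ∈ firstPos (k + q) k}) = firstEquiv rfl j := rfl
    rw [this, Equiv.permCongr_apply, Equiv.symm_apply_apply]
    simp [joinTuple, firstEquiv]
  · have hm : Fin.natAdd k j ∉ firstPos (k + q) k := by simp [firstPos]
    rw [Function.comp_apply, Equiv.Perm.ofSubtype_apply_of_not_mem _ hm]
    simp [joinTuple]

theorem joinTuple_last (e : k + q = n) (h : Fin k → H) (x : Fin q → H) (ρ : Equiv.Perm (Fin q)) :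
    joinTuple e h x ∘ Equiv.Perm.ofSubtype ((lastEquiv e).permCongr ρ) =
      joinTuple e h (x ∘ ρ) := by
  subst e
  funext i
  refine Fin.addCases (fun j => ?_) (fun j => ?_) i
  · have hm : Fin.castAdd q j ∉ lastPos (k + q) q := by simp [lastPos]
    rw [Function.comp_apply, Equiv.Perm.ofSubtype_apply_of_not_mem _ hm]
    simp [joinTuple]
  · have hm : Fin.natAdd k j ∈ lastPos (k + q) q := (lastEquiv rfl j).2
    rw [Function.comp_apply, Equiv.Perm.ofSubtype_apply_of_mem _ hm]
    have : (⟨Fin.natAdd k j, hm⟩ : {i // i ∈ lastPos (k + q) q}) = lastEquiv rfl j := rfl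
    rw [this, Equiv.permCongr_apply, Equiv.symm_apply_apply]
    simp [joinTuple, lastEquiv]

theorem symOn_pure (e : k + q = n) (h : Fin k → H) (x : Fin q → H) :
    symOn (firstPos n k) (pureTensor (joinTuple e h x)) =
      ((k.factorial : ℝ)⁻¹) • ∑ σ : Equiv.Perm (Fin k), pureTensor (joinTuple e (h ∘ σ) x) := by
  have hc : (firstPos n k).card = k := by
    simpa using (Fintype.card_congr (firstEquiv e)).symm
  simp only [symOn, hc, smul_apply, sum_apply]
  rw [← Equiv.sum_comp (firstEquiv e).permCongr]
  simp only [permute_pure, joinTuple_first]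

theorem skewOn_pure (e : k + q = n) (h : Fin k → H) (x : Fin q → H) :
    skewOn (lastPos n q) (pureTensor (joinTuple e h x)) =
      ((q.factorial : ℝ)⁻¹) • ∑ ρ : Equiv.Perm (Fin q),
        ((Equiv.Perm.sign ρ : ℤ) : ℝ) • pureTensor (joinTuple e h (x ∘ ρ)) := by
  have hc : (lastPos n q).card = q := by
    simpa using (Fintype.card_congr (lastEquiv e)).symm
  simp only [skewOn, hc, smul_apply, sum_apply]
  rw [← Equiv.sum_comp (lastEquiv e).permCongr]
  simp only [permute_pure, joinTuple_last, Equiv.Perm.sign_permCongr]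

/-- The permutation sending `p` to `j` and the other points to the other points by `σ`. -/
def extendPerm {m : ℕ} (p j : Fin (m + 1)) (σ : Equiv.Perm (Fin m)) : Equiv.Perm (Fin (m + 1)) :=
  (finSuccEquiv' p).trans ((Equiv.optionCongr σ).trans (finSuccEquiv' j).symm)

theorem extendPerm_at {m : ℕ} (p j : Fin (m + 1)) (σ : Equiv.Perm (Fin m)) :
    extendPerm p j σ p = j := by simp [extendPerm]

theorem extendPerm_succAbove {m : ℕ} (p j : Fin (m + 1)) (σ : Equiv.Perm (Fin m)) (i : Fin m) :
    extendPerm p j σ (p.succAbove i) = j.succAbove (σ i) := by simp [extendPerm]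

theorem sum_perm_succ {m : ℕ} {M : Type*} [AddCommMonoid M] (p : Fin (m + 1))
    (F : Equiv.Perm (Fin (m + 1)) → M) :
    ∑ σ, F σ = ∑ j, ∑ σ : Equiv.Perm (Fin m), F (extendPerm p j σ) := by
  rw [← Fintype.sum_prod_type' (f := fun j σ => F (extendPerm p j σ))]
  symm
  refine Function.Bijective.sum_comp (e := fun x : Fin (m + 1) × Equiv.Perm (Fin m) =>
    extendPerm p x.1 x.2) ?_ F
  rw [Fintype.bijective_iff_injective_and_card]
  refine ⟨?_, by simp [Fintype.card_perm, Nat.factorial_succ]⟩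
  rintro ⟨j, σ⟩ ⟨j', σ'⟩ h
  have hj : j = j' := by
    have := congrArg (fun f => f p) h
    simpa [extendPerm_at] using this
  subst hj
  have hs : σ = σ' := Equiv.ext fun i => by
    have := congrArg (fun f => f (p.succAbove i)) h
    simpa [extendPerm_succAbove] using this
  rw [hs]

theorem sign_extendPerm_zero {m : ℕ} (j : Fin (m + 1)) (σ : Equiv.Perm (Fin m)) :
    Equiv.Perm.sign (extendPerm 0 j σ) = (-1) ^ (j : ℕ) * Equiv.Perm.sign σ := by
  have : extendPerm 0 j σ = (Fin.cycleRange j)⁻¹ * Equiv.Perm.decomposeFin.symm (0, σ) := by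
    refine Equiv.ext fun i => ?_
    refine Fin.cases ?_ (fun i => ?_) i
    · rw [extendPerm_at, Equiv.Perm.mul_apply, Equiv.Perm.decomposeFin_symm_apply_zero]
      exact (Fin.cycleRange_symm_zero j).symm
    · have h := extendPerm_succAbove 0 j σ i
      rw [Fin.zero_succAbove] at h
      rw [h, Equiv.Perm.mul_apply, Equiv.Perm.decomposeFin_symm_apply_succ, Equiv.swap_self]
      exact (Fin.cycleRange_symm_succ j (σ i)).symm
  rw [this, Equiv.Perm.sign_mul, Equiv.Perm.sign_inv, Fin.sign_cycleRange,
    Equiv.Perm.decomposeFin.symm_sign]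
  simp

theorem cons_comp_perm (y : H) (x : Fin q → H) (ρ : Equiv.Perm (Fin q)) :
    (Fin.cons y (x ∘ ρ) : Fin (q + 1) → H) = (Fin.cons y x : Fin (q + 1) → H) ∘
      extendPerm 0 0 ρ := by
  funext i
  refine Fin.cases ?_ (fun i => ?_) i
  · simp [extendPerm_at]
  · have h := extendPerm_succAbove 0 0 ρ i
    simp only [Fin.zero_succAbove] at h
    simp [h]

theorem snoc_comp_perm (y : H) (g : Fin k → H) (σ : Equiv.Perm (Fin k)) :
    (Fin.snoc (g ∘ σ) y : Fin (k + 1) → H) = (Fin.snoc g y : Fin (k + 1) → H) ∘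
      extendPerm (Fin.last k) (Fin.last k) σ := by
  funext i
  refine Fin.lastCases ?_ (fun i => ?_) i
  · simp [extendPerm_at]
  · have h := extendPerm_succAbove (Fin.last k) (Fin.last k) σ i
    simp only [Fin.succAbove_last] at h
    simp [h]

theorem comp_extendPerm_last (h : Fin (k + 1) → H) (j : Fin (k + 1)) (σ : Equiv.Perm (Fin k)) :
    h ∘ extendPerm (Fin.last k) j σ = Fin.snoc ((h ∘ j.succAbove) ∘ σ) (h j) := by
  funext i
  refine Fin.lastCases ?_ (fun i => ?_) i
  · simp [extendPerm_at]
  · have h := extendPerm_succAbove (Fin.last k) j σ i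
    simp only [Fin.succAbove_last] at h
    simp [h]

theorem comp_extendPerm_zero (x : Fin (q + 1) → H) (j : Fin (q + 1)) (ρ : Equiv.Perm (Fin q)) :
    x ∘ extendPerm 0 j ρ = Fin.cons (x j) ((x ∘ j.succAbove) ∘ ρ) := by
  funext i
  refine Fin.cases ?_ (fun i => ?_) i
  · simp [extendPerm_at]
  · have h := extendPerm_succAbove 0 j ρ i
    simp only [Fin.zero_succAbove] at h
    simp [h]

theorem sign_sq_real {α : Type*} [DecidableEq α] [Fintype α] (ρ : Equiv.Perm α) :
    ((Equiv.Perm.sign ρ : ℤ) : ℝ) * ((Equiv.Perm.sign ρ : ℤ) : ℝ) = 1 := by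
  rcases Int.units_eq_one_or (Equiv.Perm.sign ρ) with h | h <;> simp [h]

/-- `d̆_q (h₁ ⊙ ⋯ ⊙ h_k ⊗ x₁ ∧ ⋯ ∧ x_q)
= ∑ j, h₁ ⊙ ⋯ ĥⱼ ⋯ ⊙ h_k ⊗ hⱼ ∧ x₁ ∧ ⋯ ∧ x_q` for `k ≥ 1`. -/
theorem breveD_elementary (e : k + 1 + q = n) (e' : k + (q + 1) = n) (h : Fin (k + 1) → H)
    (x : Fin q → H) :
    breveD H n q (elementary e h x) =
      ∑ j, elementary e' (h ∘ j.succAbove) (Fin.cons (h j) x : Fin (q + 1) → H) := by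
  have hq : (0 : ℤ) ≤ q ∧ (q : ℤ) < n := by omega
  have hqc : lastPos n ((q : ℤ) + 1) = lastPos n ((q + 1 : ℕ) : ℤ) := by push_cast; rfl
  have key : ∀ (g : Fin k → H) (y : H) (ρ : Equiv.Perm (Fin q)),
      ((Equiv.Perm.sign ρ : ℤ) : ℝ) • breveD H n q
        (pureTensor (joinTuple e (Fin.snoc g y : Fin (k + 1) → H) (x ∘ ρ))) =
      ((q.factorial : ℝ)⁻¹) • ∑ τ : Equiv.Perm (Fin (q + 1)),
        ((Equiv.Perm.sign τ : ℤ) : ℝ) •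
          pureTensor (joinTuple e' g ((Fin.cons y x : Fin (q + 1) → H) ∘ τ)) := by
    intro g y ρ
    have hs : Equiv.Perm.sign (extendPerm 0 0 ρ) = Equiv.Perm.sign ρ := by
      rw [sign_extendPerm_zero]; simp
    rw [breveD, if_pos hq, hqc, smul_apply, joinTuple_shift e e', skewOn_pure,
      cons_comp_perm, smul_smul, smul_smul]
    rw [← Equiv.sum_comp (Equiv.mulLeft (extendPerm 0 0 ρ)) fun τ =>
      ((Equiv.Perm.sign τ : ℤ) : ℝ) •
          pureTensor (joinTuple e' g ((Fin.cons y x : Fin (q + 1) → H) ∘ τ))]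
    simp only [Equiv.coe_mulLeft, Equiv.Perm.sign_mul, hs, Units.val_mul, Int.cast_mul,
      Equiv.Perm.coe_mul, ← Function.comp_assoc, mul_smul]
    rw [← Finset.smul_sum, smul_smul, smul_smul, smul_smul]
    have hf : ((q : ℝ) + 1) * ((q + 1).factorial : ℝ)⁻¹ = ((q.factorial : ℝ))⁻¹ := by
      rw [Nat.factorial_succ]; push_cast
      have : (q.factorial : ℝ) ≠ 0 := by positivity
      field_simp
    rw [Int.cast_natCast, mul_assoc, hf, mul_comm]
  rw [elementary, map_sum, sum_perm_succ (Fin.last k)]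
  refine Finset.sum_congr rfl fun j _ => ?_
  rw [elementary]
  refine Finset.sum_congr rfl fun σ _ => ?_
  rw [map_sum, comp_extendPerm_last]
  simp only [map_smul]
  rw [Finset.sum_congr rfl fun ρ _ => key _ _ ρ, Finset.sum_const, Finset.card_univ,
    Fintype.card_perm, Fintype.card_fin, ← Nat.cast_smul_eq_nsmul ℝ, smul_smul,
    mul_inv_cancel₀ (by positivity), one_smul]

/-- `d̆_q^* (h₁ ⊙ ⋯ ⊙ h_k ⊗ x₁ ∧ ⋯ ∧ x_{q+1})
= ∑ i, (-1)^{i-1} h₁ ⊙ ⋯ ⊙ h_k ⊙ xᵢ ⊗ x₁ ∧ ⋯ x̂ᵢ ⋯ ∧ x_{q+1}` (here `i` is counted from `0`). -/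
theorem breveDStar_elementary (e : k + 1 + q = n) (e' : k + (q + 1) = n) (h : Fin k → H)
    (x : Fin (q + 1) → H) :
    breveDStar H n q (elementary e' h x) =
      ∑ i : Fin (q + 1), ((-1 : ℝ) ^ (i : ℕ)) •
        elementary e (Fin.snoc h (x i) : Fin (k + 1) → H) (x ∘ i.succAbove) := by
  have hq : (0 : ℤ) ≤ q ∧ (q : ℤ) < n := by omega
  have hqc : firstPos n ((n : ℤ) - q) = firstPos n ((k + 1 : ℕ) : ℤ) := by
    congr 1; omega
  have key : ∀ (y : H) (z : Fin q → H) (σ : Equiv.Perm (Fin k)),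
      breveDStar H n q (pureTensor (joinTuple e' (h ∘ σ) (Fin.cons y z : Fin (q + 1) → H))) =
      ((k.factorial : ℝ)⁻¹) • ∑ τ : Equiv.Perm (Fin (k + 1)),
          pureTensor (joinTuple e ((Fin.snoc h y : Fin (k + 1) → H) ∘ τ) z) := by
    intro y z σ
    rw [breveDStar, if_pos hq, hqc, smul_apply, ← joinTuple_shift e e',
      symOn_pure, snoc_comp_perm, smul_smul]
    conv_rhs => rw [← Equiv.sum_comp (Equiv.mulLeft (extendPerm (Fin.last k) (Fin.last k) σ))]
    simp only [Equiv.coe_mulLeft, Equiv.Perm.coe_mul, ← Function.comp_assoc]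
    have hn : (n : ℝ) - ((q : ℤ) : ℝ) = k + 1 := by
      rw [← e]; push_cast; ring
    have hf : ((k : ℝ) + 1) * ((k + 1).factorial : ℝ)⁻¹ = ((k.factorial : ℝ))⁻¹ := by
      rw [Nat.factorial_succ]; push_cast
      have : (k.factorial : ℝ) ≠ 0 := by positivity
      field_simp
    rw [hn, hf]
  rw [elementary, Finset.sum_comm, map_sum, sum_perm_succ 0]
  refine Finset.sum_congr rfl fun j _ => ?_
  rw [elementary, Finset.sum_comm, Finset.smul_sum]
  refine Finset.sum_congr rfl fun ρ _ => ?_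
  rw [map_sum, comp_extendPerm_zero, sign_extendPerm_zero]
  simp only [map_smul]
  simp only [key]
  rw [← Finset.smul_sum, ← Finset.smul_sum, Finset.sum_const, Finset.card_univ, Fintype.card_perm,
    Fintype.card_fin, ← Nat.cast_smul_eq_nsmul ℝ, smul_smul (k.factorial : ℝ)⁻¹,
    inv_mul_cancel₀ (by positivity), one_smul, ← Finset.smul_sum, smul_smul]
  congr 1
  simp

/-- `d̆_n` vanishes on `H_{0,n} = H^{∧n}`. -/
theorem breveD_top : breveD H n n = 0 := by simp [breveD]

theorem symOn_eq (a : Finset (Fin n)) {x : HTensor H n} (hx : x ∈ symSkew H n a) :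
    symOn a x = x := by
  have hc : Fintype.card {i // i ∈ a} = a.card := Fintype.card_coe a
  rw [symOn, smul_apply, sum_apply, Finset.sum_congr rfl fun ρ _ => hx.1 ρ, Finset.sum_const,
    Finset.card_univ, Fintype.card_perm, hc, ← Nat.cast_smul_eq_nsmul ℝ, smul_smul,
    inv_mul_cancel₀ (by positivity), one_smul]

theorem skewOn_eq (a : Finset (Fin n)) {x : HTensor H n} (hx : x ∈ symSkew H n a) :
    skewOn aᶜ x = x := by
  have hc : Fintype.card {i // i ∈ aᶜ} = aᶜ.card := Fintype.card_coe _
  have h : ∀ ρ : Equiv.Perm {i // i ∈ aᶜ}, (((Equiv.Perm.sign ρ : ℤ) : ℝ) •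
      permute (Equiv.Perm.ofSubtype ρ) : HTensor H n →L[ℝ] HTensor H n) x = x := fun ρ => by
    rw [smul_apply, hx.2, smul_smul, sign_sq_real, one_smul]
  rw [skewOn, smul_apply, sum_apply, Finset.sum_congr rfl fun ρ _ => h ρ, Finset.sum_const,
    Finset.card_univ, Fintype.card_perm, hc, ← Nat.cast_smul_eq_nsmul ℝ, smul_smul,
    inv_mul_cancel₀ (by positivity), one_smul]

theorem compl_firstPos (e : k + q = n) : (firstPos n k)ᶜ = lastPos n q := by
  ext i
  simp only [firstPos, lastPos, Finset.mem_compl, Finset.mem_filter, Finset.mem_univ, true_and]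
  omega

theorem isClosed_symSkew (a : Finset (Fin n)) : IsClosed (symSkew H n a : Set (HTensor H n)) := by
  have : (symSkew H n a : Set (HTensor H n)) =
      (⋂ ρ : Equiv.Perm {i // i ∈ a}, {x | permute (Equiv.Perm.ofSubtype ρ) x = x}) ∩
      ⋂ ρ : Equiv.Perm {i // i ∈ aᶜ}, {x | permute (Equiv.Perm.ofSubtype ρ) x =
        ((Equiv.Perm.sign ρ : ℤ) : ℝ) • x} := by
    ext x
    simp only [Set.mem_inter_iff, Set.mem_iInter, Set.mem_ofPred_eq]
    rfl
  rw [this]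
  refine (isClosed_iInter fun ρ => isClosed_eq (by fun_prop) (by fun_prop)).inter
    (isClosed_iInter fun ρ => isClosed_eq (by fun_prop) (by fun_prop))

theorem elementary_mem (e : k + q = n) (h : Fin k → H) (x : Fin q → H) :
    elementary e h x ∈ Hkq H n k q := by
  rw [Hkq, if_pos ⟨by omega, by omega, by omega⟩]
  refine ⟨fun ρ => ?_, ?_⟩
  · obtain ⟨τ, rfl⟩ := (firstEquiv e).permCongr.surjective ρ
    simp only [elementary, map_sum, map_smul, permute_pure, joinTuple_first]
    exact Equiv.sum_comp (Equiv.mulRight τ) fun σ : Equiv.Perm (Fin k) =>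
      ∑ ρ : Equiv.Perm (Fin q), ((Equiv.Perm.sign ρ : ℤ) : ℝ) •
        pureTensor (joinTuple e (h ∘ σ) (x ∘ ρ))
  · rw [compl_firstPos e]
    intro ρ
    obtain ⟨τ, rfl⟩ := (lastEquiv e).permCongr.surjective ρ
    simp only [elementary, map_sum, map_smul, permute_pure, joinTuple_last,
      Equiv.Perm.sign_permCongr, Finset.smul_sum]
    refine Finset.sum_congr rfl fun σ _ => ?_
    rw [← Equiv.sum_comp (Equiv.mulRight τ) fun ρ : Equiv.Perm (Fin q) =>
      ((Equiv.Perm.sign τ : ℤ) : ℝ) • ((Equiv.Perm.sign ρ : ℤ) : ℝ) •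
        pureTensor (joinTuple e (h ∘ σ) (x ∘ ρ))]
    refine Finset.sum_congr rfl fun ρ _ => ?_
    simp only [Equiv.coe_mulRight, Equiv.Perm.sign_mul, Units.val_mul, Int.cast_mul, smul_smul]
    rw [mul_comm, mul_assoc, sign_sq_real, mul_one]
    rfl

/-- `H_{k,q}` is the closed linear span of the elementary tensors
`h₁ ⊙ ⋯ ⊙ h_k ⊗ x₁ ∧ ⋯ ∧ x_q`; hence the formulas `breveD_elementary` and
`breveDStar_elementary` determine `d̆_q` and `d̆_q^*` there. -/
theorem Hkq_eq_closure_span (e : k + q = n) :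
    Hkq H n k q = (Submodule.span ℝ (Set.range fun p : (Fin k → H) × (Fin q → H) =>
      elementary e p.1 p.2)).topologicalClosure := by
  have hH : Hkq H n k q = symSkew H n (firstPos n k) := by
    rw [Hkq, if_pos ⟨by omega, by omega, by omega⟩]
  apply le_antisymm
  · set C := (Submodule.span ℝ (Set.range fun p : (Fin k → H) × (Fin q → H) =>
      elementary e p.1 p.2)).topologicalClosure with hC
    let P : HTensor H n →L[ℝ] HTensor H n :=
      (symOn (firstPos n k)).comp (skewOn (lastPos n q))
    have hpure : ∀ f : Fin n → H, P (pureTensor f) ∈ C := by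
      intro f
      have hf : f = joinTuple e (fun i => f (Fin.cast e (Fin.castAdd q i)))
          (fun i => f (Fin.cast e (Fin.natAdd k i))) := by
        subst e
        funext i
        refine Fin.addCases (fun j => ?_) (fun j => ?_) i <;> simp [joinTuple]
      rw [hf]
      generalize (fun i => f (Fin.cast e (Fin.castAdd q i))) = h
      generalize (fun i => f (Fin.cast e (Fin.natAdd k i))) = x
      have : P (pureTensor (joinTuple e h x)) =
          ((q.factorial : ℝ)⁻¹ * (k.factorial : ℝ)⁻¹) • elementary e h x := by
        simp only [P, ContinuousLinearMap.comp_apply, skewOn_pure, map_smul, map_sum, symOn_pure]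
        simp only [elementary, Finset.smul_sum, mul_smul]
        rw [Finset.sum_comm]
        refine Finset.sum_congr rfl fun σ _ => Finset.sum_congr rfl fun ρ _ => ?_
        rw [smul_comm ((k.factorial : ℝ)⁻¹)]
      rw [this]
      exact C.smul_mem _ (Submodule.le_topologicalClosure _ (Submodule.subset_span ⟨(h, x), rfl⟩))
    have hall : (⊤ : Submodule ℝ (HTensor H n)) ≤ C.comap P.toLinearMap := by
      rw [← dense_span_pure]
      refine Submodule.topologicalClosure_minimal _ ?_ ?_
      · rw [Submodule.span_le]
        rintro _ ⟨f, rfl⟩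
        exact hpure f
      · exact (Submodule.isClosed_topologicalClosure _).preimage P.continuous
    intro x hx
    rw [hH] at hx
    have h1 : P x = x := by
      simp only [P, ContinuousLinearMap.comp_apply]
      rw [← compl_firstPos e, skewOn_eq _ hx, symOn_eq _ hx]
    rw [← h1]
    exact hall (Submodule.mem_top : x ∈ ⊤)
  · refine Submodule.topologicalClosure_minimal _ ?_ (hH ▸ isClosed_symSkew _)
    rw [Submodule.span_le]
    rintro _ ⟨p, rfl⟩
    exact elementary_mem e p.1 p.2

end Elementary

end FockForms
end

/-! The argument rests on the Koszul identity `koszul`: on $H_{k,q}$ with $k+q=n$, $\breve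
d_{q-1}\breve d_{q-1}^*+\breve d_q^*\breve d_q=n\,\mathrm{id}$. On an elementary tensor, moving a
vector across the tensor sign and then back returns the tensor, $q$ times in the first composite and
$k$ times in the second. Moving two different vectors in opposite directions exchanges some $h_j$
with some $x_i$, and these exchange terms occur in the two composites with opposite signs. Density
of the span of elementary tensors and continuity give the identity on all of $H_{k,q}$.

For $n>0$ the identity makes $n^{-1}\breve d^*$ a contracting homotopy: $\breve d_qx=0$ forces
$x=\breve d_{q-1}(n^{-1}\breve d_{q-1}^*x)$, so kernel ⊆ image (`ker_breveD_le`). If both operators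
kill $x$, then $nx=0$, which is the third claim.

Two further inclusions close the cycle. Image ⊆ $H^+_{k,q}$ (`map_breveD_le`): skew-symmetrisation
is a combination of permutations, and these only change the positions in which a tensor is
symmetric. $H^+_{k,q}$ ⊆ kernel (`mixed_le_ker_breveD`): $k+1$ symmetric positions and $q+1$
skew-symmetrised ones share at least two of the $n$ positions, so the result vanishes. The
statements for $\breve d^*$ and $H^-_{k,q}$ are dual. -/

namespace FockForms

/-! ### Permutations, symmetrisers and tensors with prescribed symmetry. -/

section Permutations

variable {H : Type*} [NormedAddCommGroup H] [InnerProductSpace ℝ H] {n : ℕ}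

/-- Precomposition with a permutation is a right action, hence the reversed product. On pure tensors
this is associativity of composition; density does the rest. -/
theorem permute_permute (σ τ : Equiv.Perm (Fin n)) (x : HTensor H n) :
    permute σ (permute τ x) = permute (τ * σ) x := by
  have hle : (⊤ : Submodule ℝ (HTensor H n)) ≤
      LinearMap.ker ((permute σ).comp (permute τ) - permute (τ * σ) :
        HTensor H n →L[ℝ] HTensor H n).toLinearMap := by
    rw [← dense_span_pure]
    refine Submodule.topologicalClosure_minimal _ ?_ (ContinuousLinearMap.isClosed_ker _)
    rw [Submodule.span_le]
    rintro _ ⟨f, rfl⟩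
    simp [permute_pure, Function.comp_assoc]
  have := hle (Submodule.mem_top : x ∈ ⊤)
  simpa [sub_eq_zero] using this

/-- Permutations of a subset are replaced by permutations of `Fin n` fixing the other points. In
this form they can be conjugated and compared for different subsets. -/
theorem mem_symSkew_iff {a : Finset (Fin n)} {x : HTensor H n} :
    x ∈ symSkew H n a ↔
      (∀ π : Equiv.Perm (Fin n), (∀ i ∉ a, π i = i) → permute π x = x) ∧
      ∀ π : Equiv.Perm (Fin n), (∀ i ∈ a, π i = i) →
        permute π x = ((Equiv.Perm.sign π : ℤ) : ℝ) • x := by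
  have key : ∀ (b : Finset (Fin n)) (π : Equiv.Perm (Fin n)), (∀ i ∉ b, π i = i) →
      ∃ ρ : Equiv.Perm {i // i ∈ b}, Equiv.Perm.ofSubtype ρ = π := by
    intro b π h
    have h1 : ∀ i, π i ∈ b ↔ i ∈ b := by
      intro i
      by_cases hi : i ∈ b
      · refine iff_of_true ?_ hi
        by_contra hc
        exact hc ((π.injective (h _ hc)).symm ▸ hi)
      · rw [h i hi]
    exact ⟨π.subtypePerm h1, Equiv.Perm.ofSubtype_subtypePerm h1
      fun i hi => by by_contra hc; exact hi (h i hc)⟩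
  constructor
  · rintro ⟨h1, h2⟩
    refine ⟨fun π hπ => ?_, fun π hπ => ?_⟩
    · obtain ⟨ρ, rfl⟩ := key a π hπ
      exact h1 ρ
    · obtain ⟨ρ, rfl⟩ := key aᶜ π fun i hi => hπ i (by simpa using hi)
      rw [h2 ρ, Equiv.Perm.sign_ofSubtype]
  · rintro ⟨h1, h2⟩
    refine ⟨fun ρ => h1 _ fun i hi => Equiv.Perm.ofSubtype_apply_of_not_mem ρ hi, fun ρ => ?_⟩
    rw [h2 _ fun i hi => Equiv.Perm.ofSubtype_apply_of_not_mem ρ (by simpa using hi),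
      Equiv.Perm.sign_ofSubtype]

/-- If `π` fixes the points outside (or inside) $\sigma^{-1}(a)$, then $\sigma\pi\sigma^{-1}$ fixes
those outside (or inside) $a$, and conjugation preserves the sign. -/
theorem permute_mem_symSkew (σ : Equiv.Perm (Fin n)) {a : Finset (Fin n)} {x : HTensor H n}
    (hx : x ∈ symSkew H n a) :
    permute σ x ∈ symSkew H n (a.map σ.symm.toEmbedding) := by
  rw [mem_symSkew_iff] at hx ⊢
  have hc : ∀ π : Equiv.Perm (Fin n),
      permute π (permute σ x) = permute σ (permute (σ * π * σ⁻¹) x) := fun π => by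
    rw [permute_permute, permute_permute]; congr 2; group
  refine ⟨fun π hπ => ?_, fun π hπ => ?_⟩
  · rw [hc, hx.1]
    intro i hi
    rw [Equiv.Perm.mul_apply, Equiv.Perm.mul_apply,
      hπ (σ⁻¹ i) (by simpa [Finset.mem_map_equiv] using hi)]
    exact σ.apply_symm_apply i
  · rw [hc, hx.2, map_smul]
    · rw [Equiv.Perm.sign_mul, Equiv.Perm.sign_mul, Equiv.Perm.sign_inv, mul_right_comm,
        Int.units_mul_self, one_mul]
    · intro i hi
      rw [Equiv.Perm.mul_apply, Equiv.Perm.mul_apply,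
        hπ (σ⁻¹ i) (by simpa [Finset.mem_map_equiv] using hi)]
      exact σ.apply_symm_apply i

theorem permute_swap_of_mem {a : Finset (Fin n)} {x : HTensor H n} (hx : x ∈ symSkew H n a)
    {i j : Fin n} (hi : i ∈ a) (hj : j ∈ a) : permute (Equiv.swap i j) x = x :=
  (mem_symSkew_iff.1 hx).1 _ fun l hl =>
    Equiv.swap_apply_of_ne_of_ne (by rintro rfl; exact hl hi) (by rintro rfl; exact hl hj)

theorem permute_swap_of_notMem {a : Finset (Fin n)} {x : HTensor H n} (hx : x ∈ symSkew H n a)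
    {i j : Fin n} (hij : i ≠ j) (hi : i ∉ a) (hj : j ∉ a) :
    permute (Equiv.swap i j) x = -x := by
  rw [(mem_symSkew_iff.1 hx).2 _ fun l hl =>
    Equiv.swap_apply_of_ne_of_ne (by rintro rfl; exact hi hl) (by rintro rfl; exact hj hl),
    Equiv.Perm.sign_swap hij]
  simp

/-- The sum over the group is reindexed by a translation: left multiplication when `τ` acts before
the average, right multiplication when it acts after. The next three lemmas use the same device,
with signs in the skew case. -/
theorem symOn_permute (a : Finset (Fin n)) (τ : Equiv.Perm {i // i ∈ a}) (x : HTensor H n) :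
    symOn a (permute (Equiv.Perm.ofSubtype τ) x) = symOn a x := by
  simp only [symOn, smul_apply, sum_apply, permute_permute, ← map_mul]
  congr 1
  exact Equiv.sum_comp (Equiv.mulLeft τ) fun ρ => permute (Equiv.Perm.ofSubtype ρ) x

theorem permute_symOn (a : Finset (Fin n)) (τ : Equiv.Perm {i // i ∈ a}) (x : HTensor H n) :
    permute (Equiv.Perm.ofSubtype τ) (symOn a x) = symOn a x := by
  simp only [symOn, smul_apply, sum_apply, map_smul, map_sum, permute_permute, ← map_mul]
  congr 1
  exact Equiv.sum_comp (Equiv.mulRight τ) fun ρ => permute (Equiv.Perm.ofSubtype ρ) x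

theorem skewOn_permute (a : Finset (Fin n)) (τ : Equiv.Perm {i // i ∈ a}) (x : HTensor H n) :
    skewOn a (permute (Equiv.Perm.ofSubtype τ) x) =
      ((Equiv.Perm.sign τ : ℤ) : ℝ) • skewOn a x := by
  simp only [skewOn, smul_apply, sum_apply, permute_permute, ← map_mul]
  rw [smul_comm]
  congr 1
  rw [← Equiv.sum_comp (Equiv.mulLeft τ) fun ρ => ((Equiv.Perm.sign ρ : ℤ) : ℝ) •
    permute (Equiv.Perm.ofSubtype ρ) x, Finset.smul_sum]
  refine Finset.sum_congr rfl fun ρ _ => ?_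
  simp only [Equiv.coe_mulLeft, Equiv.Perm.sign_mul, Units.val_mul, Int.cast_mul, smul_smul]
  rw [← mul_assoc, sign_sq_real, one_mul]

theorem permute_skewOn (a : Finset (Fin n)) (τ : Equiv.Perm {i // i ∈ a}) (x : HTensor H n) :
    permute (Equiv.Perm.ofSubtype τ) (skewOn a x) =
      ((Equiv.Perm.sign τ : ℤ) : ℝ) • skewOn a x := by
  simp only [skewOn, smul_apply, sum_apply, map_smul, map_sum, permute_permute, ← map_mul]
  rw [smul_comm]
  congr 1
  rw [← Equiv.sum_comp (Equiv.mulRight τ) fun ρ => ((Equiv.Perm.sign ρ : ℤ) : ℝ) •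
    permute (Equiv.Perm.ofSubtype ρ) x, Finset.smul_sum]
  refine Finset.sum_congr rfl fun ρ _ => ?_
  simp only [Equiv.coe_mulRight, Equiv.Perm.sign_mul, Units.val_mul, Int.cast_mul, smul_smul]
  rw [mul_left_comm, sign_sq_real, mul_one]

theorem eq_zero_of_eq_neg {E : Type*} [AddCommGroup E] [Module ℝ E] {y : E} (h : y = -y) :
    y = 0 := by
  have h2 : (2 : ℝ) • y = 0 := by rw [two_smul]; exact add_eq_zero_iff_eq_neg.2 h
  exact (smul_eq_zero.1 h2).resolve_left two_ne_zero

/-- Skew-symmetrising in two components in which a tensor is symmetric gives `0`. -/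
theorem skewOn_eq_zero {a b : Finset (Fin n)} (h : n + 1 < a.card + b.card) {x : HTensor H n}
    (hx : x ∈ symSkew H n a) : skewOn b x = 0 := by
  have h1 := Finset.card_union_add_card_inter a b
  have h2 := Finset.card_le_univ (a ∪ b)
  rw [Fintype.card_fin] at h2
  -- Pigeonhole: $|a\cap b|\ge|a|+|b|-n\ge2$. The swap of two common positions fixes `x` but changes
  -- the sign of `skewOn b x`.
  obtain ⟨i, hi, j, hj, hij⟩ := Finset.one_lt_card.1 (by omega : 1 < (a ∩ b).card)
  rw [Finset.mem_inter] at hi hj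
  have h3 := skewOn_permute b (Equiv.swap ⟨i, hi.2⟩ ⟨j, hj.2⟩) x
  rw [Equiv.Perm.ofSubtype_swap_eq, permute_swap_of_mem hx hi.1 hj.1,
    Equiv.Perm.sign_swap (by simpa using hij)] at h3
  have h4 : skewOn b x = -skewOn b x := by simpa using h3
  exact eq_zero_of_eq_neg h4

/-- Symmetrising in two components in which a tensor is skew-symmetric gives `0`. -/
theorem symOn_eq_zero {a b : Finset (Fin n)} (h : n + 1 < aᶜ.card + b.card) {x : HTensor H n}
    (hx : x ∈ symSkew H n a) : symOn b x = 0 := by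
  have h1 := Finset.card_union_add_card_inter aᶜ b
  have h2 := Finset.card_le_univ (aᶜ ∪ b)
  rw [Fintype.card_fin] at h2
  obtain ⟨i, hi, j, hj, hij⟩ := Finset.one_lt_card.1 (by omega : 1 < (aᶜ ∩ b).card)
  rw [Finset.mem_inter, Finset.mem_compl] at hi hj
  have h3 := symOn_permute b (Equiv.swap ⟨i, hi.2⟩ ⟨j, hj.2⟩) x
  rw [Equiv.Perm.ofSubtype_swap_eq, permute_swap_of_notMem hx hij hi.1 hj.1, map_neg] at h3
  exact eq_zero_of_eq_neg h3.symm

/-- The two permutations have disjoint supports. -/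
theorem permute_ofSubtype_comm {b : Finset (Fin n)} (ρ : Equiv.Perm {i // i ∈ b})
    {π : Equiv.Perm (Fin n)} (hπ : ∀ i ∈ b, π i = i) (x : HTensor H n) :
    permute π (permute (Equiv.Perm.ofSubtype ρ) x) =
      permute (Equiv.Perm.ofSubtype ρ) (permute π x) := by
  rw [permute_permute, permute_permute]
  congr 1
  have hd : Equiv.Perm.Disjoint (Equiv.Perm.ofSubtype ρ) π := fun i => by
    by_cases hi : i ∈ b
    · exact Or.inr (hπ i hi)
    · exact Or.inl (Equiv.Perm.ofSubtype_apply_of_not_mem ρ hi)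
  rw [hd.commute.eq]

/-- Permutations of `bᶜ` commute with each summand of `skewOn b` and, since `bᶜ ⊆ a`, fix `x`;
permutations of `b` are absorbed with their sign. -/
theorem skewOn_mem_symSkew {a b : Finset (Fin n)} (hab : bᶜ ⊆ a) {x : HTensor H n}
    (hx : x ∈ symSkew H n a) : skewOn b x ∈ symSkew H n bᶜ := by
  rw [mem_symSkew_iff] at hx
  refine ⟨fun τ => ?_, ?_⟩
  · have hτ : ∀ i ∈ b, Equiv.Perm.ofSubtype τ i = i := fun i hi =>
      Equiv.Perm.ofSubtype_apply_of_not_mem τ (by simpa using hi)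
    have hτx : permute (Equiv.Perm.ofSubtype τ) x = x := hx.1 _ fun i hi =>
      Equiv.Perm.ofSubtype_apply_of_not_mem τ fun h => hi (hab h)
    simp only [skewOn, smul_apply, sum_apply, map_smul, map_sum, permute_ofSubtype_comm _ hτ, hτx]
  · rw [compl_compl]
    exact fun ρ => permute_skewOn b ρ x

theorem symOn_mem_symSkew {a b : Finset (Fin n)} (hab : a ⊆ b) {x : HTensor H n}
    (hx : x ∈ symSkew H n a) : symOn b x ∈ symSkew H n b := by
  rw [mem_symSkew_iff] at hx
  refine ⟨fun τ => permute_symOn b τ x, fun τ => ?_⟩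
  have hτ : ∀ i ∈ b, Equiv.Perm.ofSubtype τ i = i := fun i hi =>
    Equiv.Perm.ofSubtype_apply_of_not_mem τ (by simpa using hi)
  have hτx : permute (Equiv.Perm.ofSubtype τ) x = ((Equiv.Perm.sign τ : ℤ) : ℝ) • x := by
    rw [hx.2 _ fun i hi => hτ i (hab hi), Equiv.Perm.sign_ofSubtype]
  simp only [symOn, smul_apply, sum_apply, map_smul, map_sum, permute_ofSubtype_comm _ hτ, hτx]
  rw [← Finset.smul_sum, smul_comm]

/-- A permutation moves the set of symmetric positions but keeps its cardinality, and `mixed` admits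
every set of that cardinality. Symmetrisers, being combinations of permutations, therefore land in
`mixed` too. -/
theorem permute_mem_mixed (σ : Equiv.Perm (Fin n)) {a : Finset (Fin n)} {x : HTensor H n}
    (hx : x ∈ symSkew H n a) : permute σ x ∈ mixed H n a.card (aᶜ).card := by
  refine Submodule.le_topologicalClosure _ ?_
  refine Submodule.mem_iSup_of_mem (a.map σ.symm.toEmbedding) (Submodule.mem_iSup_of_mem ?_
    (permute_mem_symSkew σ hx))
  simp [Finset.card_compl]

theorem skewOn_mem_mixed {a : Finset (Fin n)} (b : Finset (Fin n)) {x : HTensor H n}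
    (hx : x ∈ symSkew H n a) : skewOn b x ∈ mixed H n a.card (aᶜ).card := by
  simp only [skewOn, smul_apply, sum_apply]
  exact Submodule.smul_mem _ _ (Submodule.sum_mem _ fun ρ _ =>
    Submodule.smul_mem _ _ (permute_mem_mixed _ hx))

theorem symOn_mem_mixed {a : Finset (Fin n)} (b : Finset (Fin n)) {x : HTensor H n}
    (hx : x ∈ symSkew H n a) : symOn b x ∈ mixed H n a.card (aᶜ).card := by
  simp only [symOn, smul_apply, sum_apply]
  exact Submodule.smul_mem _ _ (Submodule.sum_mem _ fun ρ _ => permute_mem_mixed _ hx)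

end Permutations

/-! ### The operators: where they map, and what they annihilate. -/

section Operators

variable {H : Type*} [NormedAddCommGroup H] [InnerProductSpace ℝ H] {n k q : ℕ}

theorem Hkq_eq_symSkew (e : k + q = n) : Hkq H n k q = symSkew H n (firstPos n k) := by
  rw [Hkq, if_pos ⟨by omega, by omega, by omega⟩]

theorem card_firstPos (e : k + q = n) : (firstPos n k).card = k := by
  simpa using (Fintype.card_congr (firstEquiv e)).symm

theorem card_lastPos (e : k + q = n) : (lastPos n q).card = q := by
  simpa using (Fintype.card_congr (lastEquiv e)).symm

theorem breveD_apply (h : q < n) (x : HTensor H n) :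
    breveD H n q x = ((q : ℝ) + 1) • skewOn (lastPos n ((q + 1 : ℕ) : ℤ)) x := by
  rw [breveD, if_pos ⟨by omega, by omega⟩]
  simp

theorem breveDStar_apply (e : k + q = n) (h : q < n) (x : HTensor H n) :
    breveDStar H n q x = (k : ℝ) • symOn (firstPos n k) x := by
  have h1 : ((n : ℤ) - q) = k := by omega
  have h2 : (n : ℝ) - ((q : ℤ) : ℝ) = k := by rw [← e]; push_cast; ring
  rw [breveDStar, if_pos ⟨by omega, by omega⟩, h1, h2, smul_apply]

/-- The target is $H_{k,q+1}^+$: the symmetry in $k+1$ positions and skew-symmetry in $q$ that the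
argument had survive as membership in `mixed`. -/
theorem breveD_mem (e : k + 1 + q = n) {x : HTensor H n} (hx : x ∈ Hkq H n (k + 1 : ℕ) q) :
    breveD H n q x ∈ Hkq H n k (q + 1 : ℕ) ⊓ mixed H n (k + 1 : ℕ) q := by
  have e' : k + (q + 1) = n := by omega
  rw [Hkq_eq_symSkew e] at hx
  rw [Hkq_eq_symSkew e', breveD_apply (by omega)]
  have hc : (firstPos n ((k + 1 : ℕ) : ℤ))ᶜ.card = q := by
    rw [compl_firstPos e, card_lastPos e]
  have hf : (lastPos n ((q + 1 : ℕ) : ℤ))ᶜ = firstPos n k := by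
    rw [← compl_firstPos e', compl_compl]
  refine Submodule.smul_mem _ _ ⟨?_, ?_⟩
  · have := skewOn_mem_symSkew (b := lastPos n ((q + 1 : ℕ) : ℤ)) ?_ hx
    · rwa [hf] at this
    · rw [hf]
      intro i hi
      simp only [firstPos, Finset.mem_filter, Finset.mem_univ, true_and] at hi ⊢
      omega
  · have := skewOn_mem_mixed (lastPos n ((q + 1 : ℕ) : ℤ)) hx
    rwa [hc, card_firstPos e] at this

theorem breveDStar_mem (e : k + 1 + q = n) {x : HTensor H n} (hx : x ∈ Hkq H n k (q + 1 : ℕ)) :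
    breveDStar H n q x ∈ Hkq H n (k + 1 : ℕ) q ⊓ mixed H n k (q + 1 : ℕ) := by
  have e' : k + (q + 1) = n := by omega
  rw [Hkq_eq_symSkew e'] at hx
  rw [Hkq_eq_symSkew e, breveDStar_apply e (by omega)]
  have hc : (firstPos n (k : ℤ))ᶜ.card = q + 1 := by
    rw [compl_firstPos e', card_lastPos e']
  refine Submodule.smul_mem _ _ ⟨?_, ?_⟩
  · refine symOn_mem_symSkew ?_ hx
    intro i hi
    simp only [firstPos, Finset.mem_filter, Finset.mem_univ, true_and] at hi ⊢
    omega
  · have := symOn_mem_mixed (firstPos n ((k + 1 : ℕ) : ℤ)) hx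
    rwa [hc, card_firstPos e'] at this

/-- The kernel of a continuous operator is closed, so only the spanning subspaces need checking. -/
theorem mixed_le_ker {k q : ℤ} (T : HTensor H n →L[ℝ] HTensor H n)
    (h : ∀ a : Finset (Fin n), (a.card : ℤ) = k → (aᶜ.card : ℤ) = q →
      ∀ x ∈ symSkew H n a, T x = 0) :
    mixed H n k q ≤ LinearMap.ker T.toLinearMap := by
  refine Submodule.topologicalClosure_minimal _ ?_ (ContinuousLinearMap.isClosed_ker _)
  exact iSup₂_le fun a ha x hx => h a ha.1 ha.2 x hx

theorem mixed_le_ker_breveD (e : k + q = n) :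
    mixed H n (k + 1) (q - 1) ≤ LinearMap.ker (breveD H n q).toLinearMap := by
  refine mixed_le_ker _ fun a ha _ x hx => ?_
  rcases Nat.eq_zero_or_pos k with rfl | hk
  -- For $k=0$ there are no $q+1$ last positions to skew-symmetrise; the operator is `0` by
  -- convention.
  · obtain rfl : q = n := by omega
    rw [breveD_top]; rfl
  · have hl : (lastPos n ((q + 1 : ℕ) : ℤ)).card = q + 1 :=
      card_lastPos (k := k - 1) (by omega)
    -- The count is $(k+1)+(q+1)=n+2$, just above the bound $n+1$ of `skewOn_eq_zero`.
    rw [breveD_apply (by omega), skewOn_eq_zero (by omega) hx, smul_zero]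

theorem breveDStar_neg_one : breveDStar H n (-1) = 0 := by simp [breveDStar]

theorem mixed_le_ker_breveDStar (e : k + q = n) :
    mixed H n (k - 1) (q + 1) ≤ LinearMap.ker (breveDStar H n (q - 1)).toLinearMap := by
  refine mixed_le_ker _ fun a _ ha x hx => ?_
  rcases q with _ | q
  · simp [breveDStar_neg_one]
  · have hf := card_firstPos (k := k + 1) (q := q) (n := n) (by omega)
    have hc : (((q + 1 : ℕ) : ℤ) - 1) = (q : ℕ) := by push_cast; ring
    rw [hc, breveDStar_apply (k := k + 1) (by omega) (by omega),
      symOn_eq_zero (by push_cast at ha; omega) hx, smul_zero]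

end Operators

/-! ### The Koszul identity, on elementary tensors and then by density. -/

section Koszul

variable {H : Type*} [NormedAddCommGroup H] [InnerProductSpace ℝ H] {n k q : ℕ}

theorem elementary_comp_left (e : k + q = n) (h : Fin k → H) (x : Fin q → H)
    (τ : Equiv.Perm (Fin k)) : elementary e (h ∘ τ) x = elementary e h x := by
  simp only [elementary, Function.comp_assoc, ← Equiv.Perm.coe_mul]
  exact Equiv.sum_comp (Equiv.mulLeft τ) fun σ : Equiv.Perm (Fin k) =>
    ∑ ρ : Equiv.Perm (Fin q), ((Equiv.Perm.sign ρ : ℤ) : ℝ) •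
      pureTensor (joinTuple e (h ∘ σ) (x ∘ ρ))

theorem elementary_comp_right (e : k + q = n) (h : Fin k → H) (x : Fin q → H)
    (τ : Equiv.Perm (Fin q)) :
    elementary e h (x ∘ τ) = ((Equiv.Perm.sign τ : ℤ) : ℝ) • elementary e h x := by
  simp only [elementary, Function.comp_assoc, ← Equiv.Perm.coe_mul, Finset.smul_sum]
  refine Finset.sum_congr rfl fun σ _ => ?_
  rw [← Equiv.sum_comp (Equiv.mulLeft τ) fun ρ : Equiv.Perm (Fin q) =>
    ((Equiv.Perm.sign τ : ℤ) : ℝ) • ((Equiv.Perm.sign ρ : ℤ) : ℝ) •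
      pureTensor (joinTuple e (h ∘ σ) (x ∘ ρ))]
  refine Finset.sum_congr rfl fun ρ _ => ?_
  simp only [Equiv.coe_mulLeft, Equiv.Perm.sign_mul, Units.val_mul, Int.cast_mul, smul_smul]
  rw [← mul_assoc, sign_sq_real, one_mul]

theorem elementary_snoc (e : k + 1 + q = n) (h : Fin (k + 1) → H) (x : Fin q → H)
    (j : Fin (k + 1)) :
    elementary e (Fin.snoc (h ∘ j.succAbove) (h j) : Fin (k + 1) → H) x = elementary e h x := by
  rw [← elementary_comp_left e h x (extendPerm (Fin.last k) j 1), comp_extendPerm_last]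
  rfl

/-- Bringing `x i` to the front of the wedge is a cycle of sign $(-1)^i$. -/
theorem elementary_cons (e : k + (q + 1) = n) (h : Fin k → H) (x : Fin (q + 1) → H)
    (i : Fin (q + 1)) :
    elementary e h (Fin.cons (x i) (x ∘ i.succAbove) : Fin (q + 1) → H) =
      (-1 : ℝ) ^ (i : ℕ) • elementary e h x := by
  have h1 := elementary_comp_right e h x (extendPerm 0 i 1)
  rw [comp_extendPerm_zero, sign_extendPerm_zero] at h1
  simpa using h1

theorem cons_comp_succ_succAbove {α : Type*} (y : α) (x : Fin (q + 1) → α) (i : Fin (q + 1)) :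
    (Fin.cons y x : Fin (q + 1 + 1) → α) ∘ i.succ.succAbove =
      (Fin.cons y (x ∘ i.succAbove) : Fin (q + 1) → α) := by
  funext l
  refine Fin.cases ?_ (fun l => ?_) l <;> simp

theorem snoc_comp_castSucc_succAbove {α : Type*} (g : Fin (k + 1) → α) (y : α) (j : Fin (k + 1)) :
    (Fin.snoc g y : Fin (k + 1 + 1) → α) ∘ j.castSucc.succAbove =
      (Fin.snoc (g ∘ j.succAbove) y : Fin (k + 1) → α) := by
  funext l
  refine Fin.lastCases ?_ (fun l => ?_) l
  · simp
  · rw [Function.comp_apply, Fin.castSucc_succAbove_castSucc, Fin.snoc_castSucc,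
      Fin.snoc_castSucc, Function.comp_apply]

/-- With an empty wedge there is no $x_i$ to exchange: each of the $k+1$ vectors moves over and
back. -/
theorem breveDStar_breveD_elementary_zero (e : k + 1 + 0 = n) (h : Fin (k + 1) → H)
    (x : Fin 0 → H) :
    breveDStar H n (0 : ℕ) (breveD H n (0 : ℕ) (elementary e h x)) =
      ((k : ℝ) + 1) • elementary e h x := by
  have e' : k + (0 + 1) = n := by omega
  rw [breveD_elementary e e', map_sum]
  have : ∀ j : Fin (k + 1), breveDStar H n (0 : ℕ)
      (elementary e' (h ∘ j.succAbove) (Fin.cons (h j) x : Fin (0 + 1) → H)) =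
        elementary e h x := by
    intro j
    rw [breveDStar_elementary e e', Fin.sum_univ_succ]
    simp only [Finset.univ_eq_empty, Finset.sum_empty, add_zero, Fin.val_zero, pow_zero, one_smul,
      Fin.cons_zero]
    rw [elementary_snoc, Subsingleton.elim (_ ∘ _) x]
  rw [Finset.sum_congr rfl fun j _ => this j, Finset.sum_const, Finset.card_univ,
    Fintype.card_fin, ← Nat.cast_smul_eq_nsmul ℝ]
  push_cast
  rfl

/-- After $h_j$ has become the first wedge factor, $\breve d^*$ either returns it, giving the
original tensor for each of the $k+1$ values of $j$, or moves some $x_i$. As $x_i$ now sits one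
place further right, its sign is $(-1)^{i+1}$; this is the minus before the double sum. -/
theorem breveDStar_breveD_elementary (e : k + 1 + (q + 1) = n) (e' : k + (q + 1 + 1) = n)
    (h : Fin (k + 1) → H) (x : Fin (q + 1) → H) :
    breveDStar H n (q + 1 : ℕ) (breveD H n (q + 1 : ℕ) (elementary e h x)) =
      ((k : ℝ) + 1) • elementary e h x - ∑ j, ∑ i : Fin (q + 1), (-1 : ℝ) ^ (i : ℕ) •
        elementary e (Fin.snoc (h ∘ j.succAbove) (x i) : Fin (k + 1) → H)
          (Fin.cons (h j) (x ∘ i.succAbove) : Fin (q + 1) → H) := by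
  rw [breveD_elementary e e', map_sum]
  have : ∀ j : Fin (k + 1), breveDStar H n (q + 1 : ℕ)
      (elementary e' (h ∘ j.succAbove) (Fin.cons (h j) x : Fin (q + 1 + 1) → H)) =
        elementary e h x - ∑ i : Fin (q + 1), (-1 : ℝ) ^ (i : ℕ) •
        elementary e (Fin.snoc (h ∘ j.succAbove) (x i) : Fin (k + 1) → H)
          (Fin.cons (h j) (x ∘ i.succAbove) : Fin (q + 1) → H) := by
    intro j
    have hc : (Fin.cons (h j) x : Fin (q + 1 + 1) → H) ∘ (0 : Fin (q + 1 + 1)).succAbove = x := by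
      funext l; simp
    rw [breveDStar_elementary e e', Fin.sum_univ_succ]
    simp only [cons_comp_succ_succAbove, hc, Fin.val_zero, pow_zero, one_smul, Fin.cons_zero,
      Fin.cons_succ, elementary_snoc, Fin.val_succ, pow_succ, mul_neg, mul_one, neg_smul,
      Finset.sum_neg_distrib, sub_eq_add_neg]
  rw [Finset.sum_congr rfl fun j _ => this j, Finset.sum_sub_distrib, Finset.sum_const,
    Finset.card_univ, Fintype.card_fin, ← Nat.cast_smul_eq_nsmul ℝ]
  push_cast
  rfl

theorem breveD_breveDStar_elementary_zero (e : 0 + (q + 1) = n) (h : Fin 0 → H)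
    (x : Fin (q + 1) → H) :
    breveD H n q (breveDStar H n q (elementary e h x)) =
      ((q : ℝ) + 1) • elementary e h x := by
  have e' : 0 + 1 + q = n := by omega
  rw [breveDStar_elementary e' e, map_sum]
  have : ∀ i : Fin (q + 1), breveD H n q ((-1 : ℝ) ^ (i : ℕ) •
      elementary e' (Fin.snoc h (x i) : Fin (0 + 1) → H) (x ∘ i.succAbove)) =
        elementary e h x := by
    intro i
    rw [map_smul, breveD_elementary e' e, Fin.sum_univ_castSucc]
    simp only [Finset.univ_eq_empty, Finset.sum_empty, zero_add, Fin.snoc_last]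
    rw [elementary_cons, smul_smul, ← mul_pow, Subsingleton.elim (_ ∘ _) h]
    simp
  rw [Finset.sum_congr rfl fun j _ => this j, Finset.sum_const, Finset.card_univ,
    Fintype.card_fin, ← Nat.cast_smul_eq_nsmul ℝ]
  push_cast
  rfl

/-- After $x_i$ has joined the symmetric factors with sign $(-1)^i$, $\breve d$ either returns it to
the front of the wedge, where `elementary_cons` cancels the sign, or moves some $h_j$. The latter
terms form the double sum of `breveDStar_breveD_elementary` with the opposite sign. -/
theorem breveD_breveDStar_elementary (e : k + 1 + (q + 1) = n) (e' : k + 1 + 1 + q = n)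
    (h : Fin (k + 1) → H) (x : Fin (q + 1) → H) :
    breveD H n q (breveDStar H n q (elementary e h x)) =
      ((q : ℝ) + 1) • elementary e h x + ∑ j, ∑ i : Fin (q + 1), (-1 : ℝ) ^ (i : ℕ) •
        elementary e (Fin.snoc (h ∘ j.succAbove) (x i) : Fin (k + 1) → H)
          (Fin.cons (h j) (x ∘ i.succAbove) : Fin (q + 1) → H) := by
  rw [breveDStar_elementary e' e, map_sum]
  have : ∀ i : Fin (q + 1), breveD H n q ((-1 : ℝ) ^ (i : ℕ) •
      elementary e' (Fin.snoc h (x i) : Fin (k + 1 + 1) → H) (x ∘ i.succAbove)) =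
        elementary e h x + ∑ j, (-1 : ℝ) ^ (i : ℕ) •
        elementary e (Fin.snoc (h ∘ j.succAbove) (x i) : Fin (k + 1) → H)
          (Fin.cons (h j) (x ∘ i.succAbove) : Fin (q + 1) → H) := by
    intro i
    have hc : (Fin.snoc h (x i) : Fin (k + 1 + 1) → H) ∘ (Fin.last (k + 1)).succAbove = h := by
      funext l; simp
    rw [map_smul, breveD_elementary e' e, Fin.sum_univ_castSucc, smul_add, add_comm,
      Finset.smul_sum]
    simp only [snoc_comp_castSucc_succAbove, hc, Fin.snoc_last, Fin.snoc_castSucc,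
      elementary_cons, smul_smul, ← mul_pow]
    simp
  rw [Finset.sum_congr rfl fun j _ => this j, Finset.sum_add_distrib, Finset.sum_const,
    Finset.card_univ, Fintype.card_fin, ← Nat.cast_smul_eq_nsmul ℝ, Finset.sum_comm]
  push_cast
  rfl

theorem koszul_elementary (e : k + q = n) (h : Fin k → H) (x : Fin q → H) :
    breveD H n (q - 1) (breveDStar H n (q - 1) (elementary e h x)) +
      breveDStar H n q (breveD H n q (elementary e h x)) = (n : ℝ) • elementary e h x := by
  have hn : (n : ℝ) = k + q := by rw [← e]; push_cast; rfl
  have hq : ∀ q : ℕ, (((q + 1 : ℕ) : ℤ) - 1) = q := fun q => by push_cast; ring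
  rcases k with _ | k <;> rcases q with _ | q
  -- Both sides vanish when $n=0$; positivity of $n$ matters only later, for dividing by it.
  · obtain rfl : n = 0 := by omega
    simp [breveD, breveDStar]
  · have h0 : breveD H n (q + 1 : ℕ) = 0 := by
      obtain rfl : q + 1 = n := by omega
      exact breveD_top
    rw [h0, hq, breveD_breveDStar_elementary_zero, hn]
    simp
  · have h0 : breveDStar H n (((0 : ℕ) : ℤ) - 1) = 0 := by
      simp [breveDStar_neg_one]
    rw [h0, breveDStar_breveD_elementary_zero, hn]
    simp
  · rw [hq, breveD_breveDStar_elementary e (by omega),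
      breveDStar_breveD_elementary e (by omega), hn]
    push_cast
    module

/-- The Koszul identity `d̆_{q-1} d̆_{q-1}^* + d̆_q^* d̆_q = k + q` on `H_{k,q}`. -/
theorem koszul (e : k + q = n) {x : HTensor H n} (hx : x ∈ Hkq H n k q) :
    breveD H n (q - 1) (breveDStar H n (q - 1) x) + breveDStar H n q (breveD H n q x) =
      (n : ℝ) • x := by
  let T : HTensor H n →L[ℝ] HTensor H n :=
    (breveD H n (q - 1)).comp (breveDStar H n (q - 1)) + (breveDStar H n q).comp (breveD H n q) -
      (n : ℝ) • ContinuousLinearMap.id ℝ _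
  have hle : Hkq H n k q ≤ LinearMap.ker T.toLinearMap := by
    rw [Hkq_eq_closure_span e]
    refine Submodule.topologicalClosure_minimal _ ?_ (ContinuousLinearMap.isClosed_ker _)
    rw [Submodule.span_le]
    rintro _ ⟨p, rfl⟩
    exact sub_eq_zero.2 (koszul_elementary e p.1 p.2)
  exact sub_eq_zero.1 (hle hx)

/-! ### Images, kernels and the conclusion. -/

theorem map_breveD_le (e : k + q = n) :
    (Hkq H n (k + 1) (q - 1)).map (breveD H n (q - 1)).toLinearMap ≤ HkqPlus H n k q := by
  rcases q with _ | q
  -- The source has skew degree $-1$, so it is `⊥` by convention.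
  · rw [Hkq, if_neg]
    · rw [Submodule.map_bot]
      exact bot_le
    · omega
  · have hq : (((q + 1 : ℕ) : ℤ) - 1) = q := by push_cast; ring
    rw [HkqPlus, hq]
    rintro _ ⟨x, hx, rfl⟩
    exact breveD_mem (by omega) hx

theorem map_breveDStar_le (e : k + q = n) :
    (Hkq H n (k - 1) (q + 1)).map (breveDStar H n q).toLinearMap ≤ HkqMinus H n k q := by
  rcases k with _ | k
  · rw [Hkq, if_neg]
    · rw [Submodule.map_bot]
      exact bot_le
    · omega
  · have hk : (((k + 1 : ℕ) : ℤ) - 1) = k := by push_cast; ring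
    rw [HkqMinus, hk]
    rintro _ ⟨x, hx, rfl⟩
    exact breveDStar_mem (by omega) hx

theorem breveD_mem_Hkq (e : k + q = n) {x : HTensor H n} (hx : x ∈ Hkq H n k q) :
    breveD H n q x ∈ Hkq H n (k - 1) (q + 1) := by
  rcases k with _ | k
  · obtain rfl : q = n := by omega
    rw [breveD_top]
    exact Submodule.zero_mem _
  · have hk : (((k + 1 : ℕ) : ℤ) - 1) = k := by push_cast; ring
    rw [hk]
    exact (breveD_mem (by omega) hx).1

theorem breveDStar_mem_Hkq (e : k + q = n) {x : HTensor H n} (hx : x ∈ Hkq H n k q) :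
    breveDStar H n (q - 1) x ∈ Hkq H n (k + 1) (q - 1) := by
  rcases q with _ | q
  · simp [breveDStar_neg_one]
  · have hq : (((q + 1 : ℕ) : ℤ) - 1) = q := by push_cast; ring
    rw [hq]
    exact (breveDStar_mem (by omega) hx).1

theorem ker_breveD_le (e : k + q = n) (hpos : 0 < n) :
    Hkq H n k q ⊓ LinearMap.ker (breveD H n q).toLinearMap ≤
      (Hkq H n (k + 1) (q - 1)).map (breveD H n (q - 1)).toLinearMap := by
  rintro x ⟨hx, hk⟩
  have hk' : breveD H n q x = 0 := hk
  have hz := koszul e hx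
  rw [hk', map_zero, add_zero] at hz
  -- The preimage is read off from `koszul`, whose second term is zero here.
  refine ⟨(n : ℝ)⁻¹ • breveDStar H n (q - 1) x,
    Submodule.smul_mem _ _ (breveDStar_mem_Hkq e hx), ?_⟩
  rw [map_smul, ContinuousLinearMap.coe_coe, hz, smul_smul,
    inv_mul_cancel₀ (by positivity), one_smul]

theorem ker_breveDStar_le (e : k + q = n) (hpos : 0 < n) :
    Hkq H n k q ⊓ LinearMap.ker (breveDStar H n (q - 1)).toLinearMap ≤
      (Hkq H n (k - 1) (q + 1)).map (breveDStar H n q).toLinearMap := by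
  rintro x ⟨hx, hk⟩
  have hk' : breveDStar H n (q - 1) x = 0 := hk
  have hz := koszul e hx
  rw [hk', map_zero, zero_add] at hz
  refine ⟨(n : ℝ)⁻¹ • breveD H n q x, Submodule.smul_mem _ _ (breveD_mem_Hkq e hx), ?_⟩
  rw [map_smul, ContinuousLinearMap.coe_coe, hz, smul_smul,
    inv_mul_cancel₀ (by positivity), one_smul]

end Koszul

end FockForms

theorem mainTheorem2 {H : Type*} [NormedAddCommGroup H] [InnerProductSpace ℝ H] [CompleteSpace H]
    (n k q : ℕ) (hn : k + q = n) (hpos : 0 < n) :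
    (FockForms.HkqPlus H n k q =
        (FockForms.Hkq H n (k + 1) (q - 1)).map (FockForms.breveD H n (q - 1)).toLinearMap ∧
      FockForms.HkqPlus H n k q =
        FockForms.Hkq H n k q ⊓ LinearMap.ker (FockForms.breveD H n q).toLinearMap) ∧
    (FockForms.HkqMinus H n k q =
        (FockForms.Hkq H n (k - 1) (q + 1)).map (FockForms.breveDStar H n q).toLinearMap ∧
      FockForms.HkqMinus H n k q =
        FockForms.Hkq H n k q ⊓ LinearMap.ker (FockForms.breveDStar H n (q - 1)).toLinearMap) ∧
    (FockForms.Hkq H n k q ⊓ LinearMap.ker (FockForms.breveDStar H n (q - 1)).toLinearMap) ⊓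
        (FockForms.Hkq H n k q ⊓ LinearMap.ker (FockForms.breveD H n q).toLinearMap) = ⊥ := by
  have hP : FockForms.HkqPlus H n k q ≤
      FockForms.Hkq H n k q ⊓ LinearMap.ker (FockForms.breveD H n q).toLinearMap :=
    inf_le_inf_left _ (FockForms.mixed_le_ker_breveD hn)
  have hM : FockForms.HkqMinus H n k q ≤
      FockForms.Hkq H n k q ⊓ LinearMap.ker (FockForms.breveDStar H n (q - 1)).toLinearMap :=
    inf_le_inf_left _ (FockForms.mixed_le_ker_breveDStar hn)
  have hP' := FockForms.ker_breveD_le (H := H) hn hpos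
  have hM' := FockForms.ker_breveDStar_le (H := H) hn hpos
  have hP'' := FockForms.map_breveD_le (H := H) hn
  have hM'' := FockForms.map_breveDStar_le (H := H) hn
  -- Each triple of inclusions is a cycle $H^\pm$ ⊆ kernel ⊆ image ⊆ $H^\pm$, so all three spaces
  -- coincide.
  refine ⟨⟨le_antisymm (hP.trans hP') hP'', le_antisymm hP (hP'.trans hP'')⟩,
    ⟨le_antisymm (hM.trans hM') hM'', le_antisymm hM (hM'.trans hM'')⟩, ?_⟩
  rw [eq_bot_iff]
  rintro x ⟨⟨hx, h1⟩, -, h2⟩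
  have h1' : FockForms.breveDStar H n (q - 1) x = 0 := h1
  have h2' : FockForms.breveD H n q x = 0 := h2
  have hz := FockForms.koszul hn hx
  rw [h1', h2', map_zero, map_zero, add_zero] at hz
  have hn' : (n : ℝ) ≠ 0 := by positivity
  exact (smul_eq_zero.1 hz.symm).resolve_left hn'
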